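/- **Conventions.** Graphs are finite and simple. For a linear ordering $\prec$ of $V(G)$ and an integer $k\ge 0$, a vertex $u$ is weakly $k$-reachable from $v$ if $u\preceq v$ and $G$ contains a path from $v$ to $u$ of length at most $k$ all of whose internal vertices are greater than $u$. Let $\mathrm{wcol}_{\prec,k}(G)$ be the maximum over $v\in V(G)$ of the number of vertices weakly $k$-reachable from $v$, and $\mathrm{wcol}_k(G)=\min_{\prec}\mathrm{wcol}_{\prec,k}(G)$, the minimum over all linear orderings of $V(G)$. The intersection graph of a finite set $S$ of subsets of $\mathbb{R}^d$ has vertex set $S$, with distinct $u,v\in S$ adjacent if and only if $u\cap v\ne\emptyset$. The set $S$ is $t$-thin if every point of $\mathbb{R}^d$ lies in the interior of at most $t$ elements of $S$; a touching graph of objects of some kind is the intersection graph of a finite $1$-thin set of such objects. An axis-aligned box is a product of compact intervals of positive length; it is a hypercube (a square if $d=2$) if all these lengths are equal. A set $S$ of axis-aligned boxes is comparable if for all $u,v\in S$, a translate of $u$ is contained in $v$ or a translate of $v$ is contained in $u$. **Theorem.** For every positive integer $k$: (i) There exists a touching graph $F_k$ of comparable axis-aligned boxes in $\mathbb{R}^3$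 such that $\mathrm{wcol}_{2k}(F_k)\ge 2^{k+1}-1$. Moreover, there exist graphs $H_{k,t}$, for all integers $t\ge 1$, such that: (ii) For every integer $t\ge 1$, $H_{k,t}$ is the intersection graph of a finite $t$-thin set of axis-aligned squares in $\mathbb{R}^2$, and $\mathrm{wcol}_{2k}(H_{k,t})\ge\binom{k+t}{t}$. (iii) For every integer $d\ge 1$, the graph $H_{k,2^d-1}$ is also (isomorphic to) a touching graph of axis-aligned hypercubes in $\mathbb{R}^{d+2}$. -/

import Mathlib

/-! ### Weak coloring numbers of finite simple graphs -/

/-- `WeaklyReachable G o k v u`: with respect to the linear ordering `o` of the vertices of `G`,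
the vertex `u` is weakly `k`-reachable from `v`, that is, `u` is at most `v` and there is a path
in `G` from `v` to `u` of length at most `k` all of whose internal vertices are greater
than `u`. -/
def WeaklyReachable {V : Type*} (G : SimpleGraph V) (o : LinearOrder V) (k : ℕ) (v u : V) : Prop :=
  o.le u v ∧ ∃ p : G.Walk v u, p.IsPath ∧ p.length ≤ k ∧
    ∀ w ∈ p.support, w ≠ v → w ≠ u → o.lt u w

/-- The `k`-th weak coloring number of `G` for a given linear ordering of its vertices:
the maximum over all vertices `v` of the number of vertices weakly `k`-reachable from `v`. -/
noncomputable def wcolOrd {V : Type*} [Fintype V] (G : SimpleGraph V) (o : LinearOrder V)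
    (k : ℕ) : ℕ :=
  Finset.univ.sup fun v : V => {u : V | WeaklyReachable G o k v u}.ncard

/-- The `k`-th weak coloring number of `G`: the minimum of `wcolOrd G o k` over all linear
orderings `o` of the vertices (a finite type has at least one linear ordering). -/
noncomputable def wcol {V : Type*} [Fintype V] (G : SimpleGraph V) (k : ℕ) : ℕ :=
  ⨅ o : LinearOrder V, wcolOrd G o k

/-! ### Intersection graphs of finite sets of objects in `ℝ^d` -/

/-- The intersection graph of a finite set `S` of subsets of `ℝ^d`: its vertices are the elements
of `S`, and two distinct elements are adjacent if and only if they intersect. -/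
def intersectionGraph {d : ℕ} (S : Finset (Set (Fin d → ℝ))) : SimpleGraph S where
  Adj u v := u ≠ v ∧ ((u : Set (Fin d → ℝ)) ∩ (v : Set (Fin d → ℝ))).Nonempty
  symm := ⟨fun u v h => ⟨h.1.symm, by rw [Set.inter_comm]; exact h.2⟩⟩
  loopless := ⟨fun _ h => h.1 rfl⟩

/-- A finite set `S` of objects is `t`-thin if every point of `ℝ^d` is contained in the interior
of at most `t` elements of `S`. -/
def IsThin {d : ℕ} (t : ℕ) (S : Finset (Set (Fin d → ℝ))) : Prop :=
  ∀ p : Fin d → ℝ, {u : Set (Fin d → ℝ) | u ∈ S ∧ p ∈ interior u}.ncard ≤ t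

/-- A touching representation is a `1`-thin set of objects. -/
def IsTouching {d : ℕ} (S : Finset (Set (Fin d → ℝ))) : Prop := IsThin 1 S

/-- An axis-aligned box: a product of `d` compact intervals of positive length. -/
def IsBox {d : ℕ} (u : Set (Fin d → ℝ)) : Prop :=
  ∃ a b : Fin d → ℝ, (∀ i, a i < b i) ∧ u = Set.Icc a b

/-- An axis-aligned hypercube: a product of `d` compact intervals of the same positive length.
For `d = 2` this is an axis-aligned square. -/
def IsHypercube {d : ℕ} (u : Set (Fin d → ℝ)) : Prop :=
  ∃ (a : Fin d → ℝ) (s : ℝ), 0 < s ∧ u = Set.Icc a (fun i => a i + s)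

/-- `S` is a set of comparable axis-aligned boxes: for all `u, v ∈ S`, a translate of `u` is a
subset of `v` or a translate of `v` is a subset of `u`. -/
def IsComparableBoxes {d : ℕ} (S : Finset (Set (Fin d → ℝ))) : Prop :=
  (∀ u ∈ S, IsBox u) ∧
    ∀ u ∈ S, ∀ v ∈ S,
      (∃ c : Fin d → ℝ, (fun x => c + x) '' u ⊆ v) ∨ (∃ c : Fin d → ℝ, (fun x => c + x) '' v ⊆ u)

/-!
The lower bounds come from recursive constructions in which the ordering of the vertices is
controlled by the pigeonhole principle: if a vertex `v` has `M` neighbours, one of them is larger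
than `v`, or `v` weakly `1`-reaches `M` vertices. With `M` the bound to be proved, the second case
is a success, so every construction may assume the first. `ForcesReach G act k n M` says that a
graph `G`, under every ordering, either succeeds in this way or has a vertex in the set `act` of
active vertices that weakly `k`-reaches `n` vertices. The weak coloring numbers are bounded already
for paths of length `k`, hence also for length `2 * k`.

Squares. `ForcesReach.attach` joins every active vertex of a graph for `(k, t)` to the active
vertices of `M` copies of a graph for `(k + 1, t - 1)`. The numbers of reached vertices add up, as
in Pascal's rule, to `(k + 1 + t).choose t`. The active vertices of the copies are the new active
ones; the old ones need no further attachments, and this is what makes the plane sufficient.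
The active squares of a family (`IsComb`) are unit squares standing against the left boundary line
of the family, with nothing else near that line in their strips. To attach the copies
(`attachSquares`), the old family is magnified and shifted to the right by `1`, and the copies are
stacked in front of the old active squares, against the new boundary line. Each new active square
then touches the old one, and a copy overlaps only the one old square it is attached to. So the
copies can be coloured with the `t - 1` colours different from that of the old square, and squares
of equal colour have disjoint interiors (`exists_comb`). This gives `t`-thinness, and placing the
`t ≤ 2 ^ d` colours in different orthants of `ℝ^d` gives a touching family of hypercubes with the
same intersection graph (`exists_touching_hypercubes`).

Boxes. `ForcesReach.bridge` takes, for each active `v`, a copy of the whole graph and puts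
`2 * M` connecting vertices between `v` and each active `w` of the copy. A connecting vertex that
is larger than `v` and `w` reaches what both of them reach, and itself, so `n` grows to
`2 * n + 1`. All boxes are unit intervals times squares, hence comparable. The active boxes
(`IsTiling`) stand on the bottom plane of the family. The copies of the family are put next to the
active boxes in the first direction, and the connecting boxes are put below both, where `v` and `w`
meet the same vertical plane (`bridgeBricks`).
-/

/-! ### Weak reachability along walks -/

/-- The vertices reached from `v` by a walk of length at most `k` on which the end vertex has the
smallest value of `r`. For an injective `r` these are the vertices weakly `k`-reachable from `v`
in the ordering by `r`. -/
def reachSet {V β : Type*} [LinearOrder β] (G : SimpleGraph V) (r : V → β) (k : ℕ) (v : V) :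
    Set V :=
  {u | ∃ p : G.Walk v u, p.length ≤ k ∧ ∀ w ∈ p.support, r u ≤ r w}

section reachSet

variable {V W β : Type*} [LinearOrder β] {G : SimpleGraph V} {H : SimpleGraph W}

theorem reachSet_mono (r : V → β) {k l : ℕ} (hkl : k ≤ l) (v : V) :
    reachSet G r k v ⊆ reachSet G r l v := by
  rintro u ⟨p, hp, hr⟩
  exact ⟨p, hp.trans hkl, hr⟩

theorem self_mem_reachSet (r : V → β) (k : ℕ) (v : V) : v ∈ reachSet G r k v :=
  ⟨.nil, by simp, by simp⟩

theorem le_of_mem_reachSet {r : V → β} {k : ℕ} {u v : V} (h : u ∈ reachSet G r k v) :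
    r u ≤ r v := by
  obtain ⟨p, -, hr⟩ := h
  exact hr v p.start_mem_support

theorem mem_reachSet_one {r : V → β} {u v : V} (hadj : G.Adj v u) (hr : r u ≤ r v) :
    u ∈ reachSet G r 1 v :=
  ⟨hadj.toWalk, by simp, by simp [hr]⟩

theorem mem_reachSet_succ {r : V → β} {k : ℕ} {u v w : V} (hadj : G.Adj w v) (hr : r v ≤ r w)
    (h : u ∈ reachSet G r k v) : u ∈ reachSet G r (k + 1) w := by
  have huv := le_of_mem_reachSet h
  obtain ⟨p, hp, hpr⟩ := h
  refine ⟨.cons hadj p, by simpa using hp, fun a ha => ?_⟩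
  rw [SimpleGraph.Walk.support_cons, List.mem_cons] at ha
  rcases ha with rfl | ha
  · exact huv.trans hr
  · exact hpr a ha

theorem image_reachSet_subset (f : H →g G) (r : V → β) (k : ℕ) (v : W) :
    f '' reachSet H (r ∘ f) k v ⊆ reachSet G r k (f v) := by
  rintro _ ⟨u, ⟨p, hp, hr⟩, rfl⟩
  refine ⟨p.map f, by simpa using hp, fun w hw => ?_⟩
  rw [SimpleGraph.Walk.support_map, List.mem_map] at hw
  obtain ⟨a, ha, rfl⟩ := hw
  exact hr a ha

theorem ncard_reachSet_le_of_hom [Finite V] (f : H →g G) (hf : Function.Injective f) (r : V → β)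
    (k : ℕ) (v : W) : (reachSet H (r ∘ f) k v).ncard ≤ (reachSet G r k (f v)).ncard := by
  rw [← Set.ncard_image_of_injective _ hf]
  exact Set.ncard_le_ncard (image_reachSet_subset f r k v)

end reachSet

/-- For every ordering of the vertices of `G`, some vertex of `act` weakly `k`-reaches at least
`n` vertices, unless some vertex weakly `1`-reaches at least `M` vertices. An ordering is given
by an injective map to a linear order. -/
def ForcesReach {V : Type} (G : SimpleGraph V) (act : Set V) (k n M : ℕ) : Prop :=
  ∀ (β : Type) [LinearOrder β] (r : V → β), Function.Injective r →
    (∃ v, M ≤ (reachSet G r 1 v).ncard) ∨ ∃ v ∈ act, n ≤ (reachSet G r k v).ncard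

theorem forcesReach_one {V : Type} [Finite V] (G : SimpleGraph V) {act : Set V}
    (hact : act.Nonempty) (k M : ℕ) : ForcesReach G act k 1 M := by
  intro β _ r _
  obtain ⟨v, hv⟩ := hact
  exact .inr ⟨v, hv, (Set.ncard_pos).2 ⟨v, self_mem_reachSet r k v⟩⟩

theorem weaklyReachable_of_mem_reachSet {V : Type*} {G : SimpleGraph V} (o : LinearOrder V)
    {k : ℕ} {u v : V} (h : u ∈ @reachSet V V o G id k v) : WeaklyReachable G o k v u := by
  classical
  refine ⟨le_of_mem_reachSet h, ?_⟩
  obtain ⟨p, hp, hr⟩ := h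
  refine ⟨p.bypass, p.bypass_isPath, p.length_bypass_le_length.trans hp, fun w hw _ hwu => ?_⟩
  exact lt_of_le_of_ne (hr w (p.support_bypass_subset_support hw)) (Ne.symm hwu)

theorem le_wcol_of_forcesReach {V W : Type} [Finite V] [Fintype W] {G : SimpleGraph V}
    {act : Set V} {G' : SimpleGraph W} (e : G ≃g G') {k l n : ℕ} (hkl : k ≤ l) (hl : 1 ≤ l)
    (h : ForcesReach G act k n n) : n ≤ wcol G' l := by
  classical
  have : Nonempty (LinearOrder W) :=
    ⟨LinearOrder.lift' (Fintype.equivFin W) (Fintype.equivFin W).injective⟩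
  refine le_ciInf fun o => ?_
  have key : ∃ v k', k' ≤ l ∧ n ≤ (reachSet G e k' v).ncard := by
    rcases h W e e.injective with ⟨v, hv⟩ | ⟨v, -, hv⟩
    · exact ⟨v, 1, hl, hv⟩
    · exact ⟨v, k, hkl, hv⟩
  obtain ⟨v, k', hk', hv⟩ := key
  have h1 : (reachSet G e k' v).ncard ≤ (reachSet G' id k' (e v)).ncard :=
    ncard_reachSet_le_of_hom e.toHom e.injective id k' v
  have h2 : (reachSet G' id k' (e v)).ncard ≤ {u : W | WeaklyReachable G' o l (e v) u}.ncard :=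
    Set.ncard_le_ncard fun u hu => weaklyReachable_of_mem_reachSet o (reachSet_mono id hk' _ hu)
  exact (hv.trans (h1.trans h2)).trans
    (Finset.le_sup (f := fun v : W => {u : W | WeaklyReachable G' o l v u}.ncard)
      (Finset.mem_univ (e v)))

/-! ### Gluing copies of graphs -/

/-- Suppose that every active vertex `v` of `G` is joined, for each of `M` disjoint copies of `H`,
to all active vertices of the copy. Let `v` and, in each copy, `w` be the vertices forced by `G`
and by `H`. If `w` is smaller than `v` in every copy, then `v` reaches `M` vertices in one step;
otherwise some `w` reaches, besides what it reaches in its copy, also all that `v` reaches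
in `G`. -/
theorem ForcesReach.attach {V W : Type} [Finite V] [Finite W] {G : SimpleGraph V}
    {H : SimpleGraph W} {actG : Set V} {actH : Set W} {k m n M : ℕ}
    (hG : ForcesReach G actG k m M) (hH : ForcesReach H actH (k + 1) n M)
    (K : SimpleGraph (V ⊕ actG × Fin M × W))
    (hGK : ∀ a b, G.Adj a b → K.Adj (.inl a) (.inl b))
    (hHK : ∀ v i a b, H.Adj a b → K.Adj (.inr (v, i, a)) (.inr (v, i, b)))
    (hadj : ∀ (v : actG) (i : Fin M), ∀ w ∈ actH, K.Adj (.inl v) (.inr (v, i, w))) :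
    ForcesReach K {p | ∃ v i, ∃ w ∈ actH, p = .inr (v, i, w)} (k + 1) (m + n) M := by
  intro β _ r hr
  let f : G →g K := ⟨Sum.inl, fun {a b} h => hGK a b h⟩
  have hf : Function.Injective f := Sum.inl_injective
  let g (v : actG) (i : Fin M) : H →g K := ⟨fun w => .inr (v, i, w), fun {a b} h => hHK v i a b h⟩
  have hg : ∀ v i, Function.Injective (g v i) := fun v i a b h => by
    simpa [g] using h
  rcases hG β (r ∘ f) (hr.comp hf) with ⟨v, hv⟩ | ⟨v, hvact, hv⟩
  · exact .inl ⟨_, hv.trans (ncard_reachSet_le_of_hom f hf r 1 v)⟩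
  by_cases hbad : ∃ i w, M ≤ (reachSet H (r ∘ g ⟨v, hvact⟩ i) 1 w).ncard
  · obtain ⟨i, w, hw⟩ := hbad
    exact .inl ⟨_, hw.trans (ncard_reachSet_le_of_hom _ (hg _ i) r 1 w)⟩
  have hex : ∀ i, ∃ w ∈ actH, n ≤ (reachSet H (r ∘ g ⟨v, hvact⟩ i) (k + 1) w).ncard := by
    intro i
    rcases hH β (r ∘ g ⟨v, hvact⟩ i) (hr.comp (hg _ i)) with ⟨w, hw⟩ | h
    · exact absurd ⟨i, w, hw⟩ hbad
    · exact h
  choose w hwact hw using hex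
  by_cases hlt : ∃ i, r (f v) ≤ r (g ⟨v, hvact⟩ i (w i))
  · obtain ⟨i, hi⟩ := hlt
    refine .inr ⟨_, ⟨⟨v, hvact⟩, i, w i, hwact i, rfl⟩, ?_⟩
    have hsub : f '' reachSet G (r ∘ f) k v ∪
        g ⟨v, hvact⟩ i '' reachSet H (r ∘ g ⟨v, hvact⟩ i) (k + 1) (w i) ⊆
        reachSet K r (k + 1) (g ⟨v, hvact⟩ i (w i)) := by
      refine Set.union_subset (fun u hu => ?_) (image_reachSet_subset _ r _ _)
      exact mem_reachSet_succ (hadj ⟨v, hvact⟩ i _ (hwact i)).symm hi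
        (image_reachSet_subset f r k v hu)
    have hdisj : Disjoint (f '' reachSet G (r ∘ f) k v)
        (g ⟨v, hvact⟩ i '' reachSet H (r ∘ g ⟨v, hvact⟩ i) (k + 1) (w i)) := by
      rw [Set.disjoint_left]
      rintro _ ⟨a, -, rfl⟩ ⟨b, -, hb⟩
      cases hb
    have := Set.ncard_le_ncard hsub
    rw [Set.ncard_union_eq hdisj, Set.ncard_image_of_injective _ hf,
      Set.ncard_image_of_injective _ (hg _ i)] at this
    exact (add_le_add hv (hw i)).trans this
  · simp only [not_exists, not_le] at hlt
    refine .inl ⟨f v, ?_⟩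
    have hinj : Function.Injective fun i => g ⟨v, hvact⟩ i (w i) := fun i j hij => by
      have := congrArg (Sum.elim (fun _ => i) fun p => p.2.1) hij
      exact this
    have hsub : Set.range (fun i => g ⟨v, hvact⟩ i (w i)) ⊆ reachSet K r 1 (f v) := by
      rintro _ ⟨i, rfl⟩
      exact mem_reachSet_one (hadj ⟨v, hvact⟩ i _ (hwact i)) (hlt i).le
    have := Set.ncard_le_ncard hsub
    rwa [Set.ncard_range_of_injective hinj, Nat.card_fin] at this

/-- Suppose that every active vertex `v` of `G` has its own copy of `H`, and that for every active
vertex `w` of this copy there are `2 * M` new vertices adjacent to both `v` and `w`. If `v` and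
`w` are the vertices forced by `G` and by `H`, then one of the new vertices is larger than both
(otherwise `v` or `w` reaches `M` vertices in one step), and it reaches itself and all that `v`
and `w` reach. -/
theorem ForcesReach.bridge {V W : Type} [Finite V] [Finite W] {G : SimpleGraph V}
    {H : SimpleGraph W} {actG : Set V} {actH : Set W} {k m n M : ℕ}
    (hG : ForcesReach G actG k m M) (hH : ForcesReach H actH k n M)
    (K : SimpleGraph (V ⊕ actG × W ⊕ actG × actH × Fin (2 * M)))
    (hGK : ∀ a b, G.Adj a b → K.Adj (.inl a) (.inl b))
    (hHK : ∀ v a b, H.Adj a b → K.Adj (.inr (.inl (v, a))) (.inr (.inl (v, b))))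
    (hadjG : ∀ v w i, K.Adj (.inl v.1) (.inr (.inr (v, w, i))))
    (hadjH : ∀ v w i, K.Adj (.inr (.inl (v, w.1))) (.inr (.inr (v, w, i)))) :
    ForcesReach K (Set.range fun q => .inr (.inr q)) (k + 1) (m + n + 1) M := by
  intro β _ r hr
  let f : G →g K := ⟨Sum.inl, fun {a b} h => hGK a b h⟩
  have hf : Function.Injective f := Sum.inl_injective
  rcases hG β (r ∘ f) (hr.comp hf) with ⟨v, hv⟩ | ⟨v, hvact, hv⟩
  · exact .inl ⟨_, hv.trans (ncard_reachSet_le_of_hom f hf r 1 v)⟩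
  let g : H →g K := ⟨fun w => .inr (.inl (⟨v, hvact⟩, w)), fun {a b} h => hHK ⟨v, hvact⟩ a b h⟩
  have hg : Function.Injective g := fun a b h => by
    simpa [g] using h
  rcases hH β (r ∘ g) (hr.comp hg) with ⟨w, hw⟩ | ⟨w, hwact, hw⟩
  · exact .inl ⟨_, hw.trans (ncard_reachSet_le_of_hom g hg r 1 w)⟩
  let c (i : Fin (2 * M)) : V ⊕ actG × W ⊕ actG × actH × Fin (2 * M) :=
    .inr (.inr (⟨v, hvact⟩, ⟨w, hwact⟩, i))
  have hc : Function.Injective c := fun i j hij => by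
    simpa [c] using hij
  by_cases hbig : ∃ i, r (f v) ≤ r (c i) ∧ r (g w) ≤ r (c i)
  · obtain ⟨i, hiv, hiw⟩ := hbig
    refine .inr ⟨c i, ⟨_, rfl⟩, ?_⟩
    have hsub : insert (c i) (f '' reachSet G (r ∘ f) k v ∪ g '' reachSet H (r ∘ g) k w) ⊆
        reachSet K r (k + 1) (c i) := by
      refine Set.insert_subset (self_mem_reachSet r _ _)
        (Set.union_subset (fun u hu => ?_) (fun u hu => ?_))
      · exact mem_reachSet_succ (hadjG ⟨v, hvact⟩ ⟨w, hwact⟩ i).symm hiv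
          (image_reachSet_subset f r k v hu)
      · exact mem_reachSet_succ (hadjH ⟨v, hvact⟩ ⟨w, hwact⟩ i).symm hiw
          (image_reachSet_subset g r k w hu)
    have hdisj : Disjoint (f '' reachSet G (r ∘ f) k v) (g '' reachSet H (r ∘ g) k w) := by
      rw [Set.disjoint_left]
      rintro _ ⟨a, -, rfl⟩ ⟨b, -, hb⟩
      cases hb
    have hnot : c i ∉ f '' reachSet G (r ∘ f) k v ∪ g '' reachSet H (r ∘ g) k w := by
      rintro (⟨a, -, ha⟩ | ⟨a, -, ha⟩) <;> cases ha
    have := Set.ncard_le_ncard hsub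
    rw [Set.ncard_insert_of_notMem hnot, Set.ncard_union_eq hdisj,
      Set.ncard_image_of_injective _ hf, Set.ncard_image_of_injective _ hg] at this
    exact (Nat.add_le_add_right (add_le_add hv hw) 1).trans this
  · have hsub : Set.range c ⊆ reachSet K r 1 (f v) ∪ reachSet K r 1 (g w) := by
      rintro _ ⟨i, rfl⟩
      by_cases hi : r (f v) ≤ r (c i)
      · exact .inr (mem_reachSet_one (hadjH ⟨v, hvact⟩ ⟨w, hwact⟩ i)
          (not_le.1 fun h => hbig ⟨i, hi, h⟩).le)
      · exact .inl (mem_reachSet_one (hadjG ⟨v, hvact⟩ ⟨w, hwact⟩ i) (not_le.1 hi).le)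
    have h1 := (Set.ncard_le_ncard hsub).trans (Set.ncard_union_le _ _)
    rw [Set.ncard_range_of_injective hc, Nat.card_fin] at h1
    by_cases h2 : M ≤ (reachSet K r 1 (f v)).ncard
    · exact .inl ⟨_, h2⟩
    · exact .inl ⟨g w, by omega⟩

/-! ### Indexed families of boxes -/

/-- The intersection graph of an indexed family of sets. -/
def meetGraph {V : Type*} {d : ℕ} (F : V → Set (Fin d → ℝ)) : SimpleGraph V where
  Adj u v := u ≠ v ∧ (F u ∩ F v).Nonempty
  symm := ⟨fun u v h => ⟨h.1.symm, by rw [Set.inter_comm]; exact h.2⟩⟩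
  loopless := ⟨fun _ h => h.1 rfl⟩

open Classical in
theorem nonempty_meetGraph_iso {V : Type*} [Fintype V] {d : ℕ} {F : V → Set (Fin d → ℝ)}
    (hF : Function.Injective F) :
    Nonempty (meetGraph F ≃g intersectionGraph (Finset.univ.image F)) := by
  let e : V ≃ (Finset.univ.image F : Finset (Set (Fin d → ℝ))) :=
    Equiv.ofBijective (fun v => ⟨F v, Finset.mem_image_of_mem F (Finset.mem_univ v)⟩)
      ⟨fun u v h => hF (congrArg Subtype.val h), fun ⟨s, hs⟩ => by
        obtain ⟨v, -, rfl⟩ := Finset.mem_image.1 hs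
        exact ⟨v, rfl⟩⟩
  refine ⟨⟨e, fun {u v} => ?_⟩⟩
  change (e u ≠ e v ∧ (F u ∩ F v).Nonempty) ↔ (u ≠ v ∧ (F u ∩ F v).Nonempty)
  rw [e.injective.ne_iff]

theorem interior_Icc_pi {d : ℕ} {a b p : Fin d → ℝ} (h : p ∈ interior (Set.Icc a b)) (i : Fin d) :
    a i < p i ∧ p i < b i := by
  rw [← Set.pi_univ_Icc, interior_pi_set Set.finite_univ] at h
  simpa [interior_Icc] using h i (Set.mem_univ i)

theorem Icc_ends_eq {α : Type*} [PartialOrder α] {a b a' b' : α} (h : a ≤ b) (h' : a' ≤ b')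
    (heq : Set.Icc a b = Set.Icc a' b') : a = a' ∧ b = b' :=
  ⟨(isLeast_Icc h).unique (by rw [heq]; exact isLeast_Icc h'),
    (isGreatest_Icc h).unique (by rw [heq]; exact isGreatest_Icc h')⟩

theorem Icc_inter_Icc_nonempty_iff {d : ℕ} {a b a' b' : Fin d → ℝ} (h : a ≤ b) (h' : a' ≤ b') :
    (Set.Icc a b ∩ Set.Icc a' b').Nonempty ↔ ∀ i, a i ≤ b' i ∧ a' i ≤ b i := by
  rw [Set.Icc_inter_Icc, Set.nonempty_Icc, sup_le_iff, le_inf_iff, le_inf_iff, ← forall_and.symm]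
  exact ⟨fun hh => ⟨hh.1.2, hh.2.1⟩, fun hh => ⟨⟨h, hh.1⟩, hh.2, h'⟩⟩

/-- A family in which sets of equal colour have disjoint interiors is as thin as the number of
colours. -/
theorem isThin_image_of_coloring {V C : Type*} [Fintype V] [Fintype C] {d : ℕ}
    [DecidableEq (Set (Fin d → ℝ))] (F : V → Set (Fin d → ℝ)) (col : V → C)
    (h : ∀ u v p, col u = col v → p ∈ interior (F u) → p ∈ interior (F v) → u = v) :
    IsThin (Fintype.card C) (Finset.univ.image F) := by
  intro p
  have hsub : {s | s ∈ Finset.univ.image F ∧ p ∈ interior s} ⊆ F '' {v | p ∈ interior (F v)} := by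
    rintro s ⟨hs, hp⟩
    obtain ⟨v, -, rfl⟩ := Finset.mem_image.1 hs
    exact ⟨v, hp, rfl⟩
  calc _ ≤ (F '' {v | p ∈ interior (F v)}).ncard := Set.ncard_le_ncard hsub
    _ ≤ {v | p ∈ interior (F v)}.ncard := Set.ncard_image_le
    _ = (col '' {v | p ∈ interior (F v)}).ncard := by
      exact (Set.InjOn.ncard_image fun u hu v hv huv => h u v p huv hu hv).symm
    _ ≤ Fintype.card C := by
      rw [← Nat.card_eq_fintype_card]
      exact Set.ncard_le_card _

/-! ### Squares with integer coordinates -/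

/-- The data of the square `[x, x + s] × [y, y + s]`. -/
structure Square where
  /-- The left end of the horizontal side. -/
  x : ℕ
  /-- The lower end of the vertical side. -/
  y : ℕ
  /-- The side length. -/
  s : ℕ

namespace Square

/-- The two squares are separated by a vertical or horizontal line, which they may touch. -/
def Sep (p q : Square) : Prop :=
  p.x + p.s ≤ q.x ∨ q.x + q.s ≤ p.x ∨ p.y + p.s ≤ q.y ∨ q.y + q.s ≤ p.y

/-- The two closed squares intersect. -/
def Meets (p q : Square) : Prop :=
  p.x ≤ q.x + q.s ∧ q.x ≤ p.x + p.s ∧ p.y ≤ q.y + q.s ∧ q.y ≤ p.y + p.s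

/-- The projections of the two squares to the vertical axis do not overlap. -/
def SepY (p q : Square) : Prop :=
  p.y + p.s ≤ q.y ∨ q.y + q.s ≤ p.y

theorem SepY.symm {p q : Square} (h : p.SepY q) : q.SepY p := Or.symm h

theorem SepY.sep {p q : Square} (h : p.SepY q) : p.Sep q := .inr (.inr h)

/-- The intersection graph of a family of squares. -/
def graph {V : Type*} (Q : V → Square) : SimpleGraph V where
  Adj u v := u ≠ v ∧ (Q u).Meets (Q v)
  symm := ⟨fun _ _ h => ⟨h.1.symm, h.2.2.1, h.2.1, h.2.2.2.2, h.2.2.2.1⟩⟩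
  loopless := ⟨fun _ h => h.1 rfl⟩

end Square

/-! ### Recursive families of squares -/

section Squares

open Square

/-- A family of squares with a set `act` of active members. The family lies in the half-plane
`0 ≤ x`. The active squares are unit squares with left side on the line `x = 0`, and to the left
of the line `x = 1` no other square enters the interior of the horizontal strip spanned by an
active square. -/
structure IsComb {V : Type*} (Q : V → Square) (act : Set V) : Prop where
  inj : Function.Injective Q
  pos : ∀ v, 0 < (Q v).s
  act_x : ∀ v ∈ act, (Q v).x = 0
  act_s : ∀ v ∈ act, (Q v).s = 1
  free : ∀ v ∈ act, ∀ u, u ≠ v → (Q u).SepY (Q v) ∨ 1 ≤ (Q u).x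

/-- The family obtained from `Q` and `R` by enlarging `Q` by the factor `M * L + 1`, shifting it
by `1` to the right, and stacking `M` copies of `R` along the left side of each square that was
active in `Q`. Here `L` bounds the extent of `R`. -/
def attachSquares {V W : Type*} (Q : V → Square) (act : Set V) (R : W → Square) (M L : ℕ) :
    V ⊕ act × Fin M × W → Square
  | .inl v => ⟨(M * L + 1) * (Q v).x + 1, (M * L + 1) * (Q v).y, (M * L + 1) * (Q v).s⟩
  | .inr (v, i, w) => ⟨(R w).x, (M * L + 1) * (Q v).y + i * L + (R w).y, (R w).s⟩

section attachSquares

variable {V W : Type*} {Q : V → Square} {act : Set V} {R : W → Square} {M L : ℕ}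

theorem scale_le {a b c : ℕ} (k : ℕ) (h : a + b ≤ c) : k * a + k * b ≤ k * c := by
  rw [← mul_add]
  exact Nat.mul_le_mul_left k h

theorem copy_y_range (hL : ∀ w, (R w).y + (R w).s ≤ L) (i : Fin M) (w : W) :
    i * L + (R w).y + (R w).s ≤ M * L := by
  have h1 := hL w
  have h2 : ((i : ℕ) + 1) * L ≤ M * L := Nat.mul_le_mul_right L i.2
  rw [add_mul] at h2
  omega

theorem attach_sepY_inl_inr (hQ : IsComb Q act) (hL : ∀ w, (R w).y + (R w).s ≤ L) {u : V}
    {v : act} (h : (Q u).SepY (Q v)) (i : Fin M) (w : W) :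
    (attachSquares Q act R M L (.inl u)).SepY (attachSquares Q act R M L (.inr (v, i, w))) := by
  have h1 := copy_y_range hL i w
  simp only [SepY, attachSquares, hQ.act_s v v.2] at h ⊢
  rcases h with h | h
  · have := scale_le (M * L + 1) h
    omega
  · have := scale_le (M * L + 1) h
    omega

theorem attach_sep_inl_inr (hQ : IsComb Q act) (hM : 1 ≤ M)
    (hL : ∀ w, (R w).y + (R w).s ≤ L) (hL' : ∀ w, (R w).x + (R w).s ≤ L) {u : V}
    {v : act} (h : u ≠ v) (i : Fin M) (w : W) :
    (attachSquares Q act R M L (.inr (v, i, w))).Sep (attachSquares Q act R M L (.inl u)) := by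
  rcases hQ.free v v.2 u h with h | h
  · exact (attach_sepY_inl_inr hQ hL h i w).symm.sep
  · left
    have h1 := hL' w
    have h2 : 1 * L ≤ M * L := Nat.mul_le_mul_right L hM
    have h3 : (M * L + 1) * 1 ≤ (M * L + 1) * (Q u).x := Nat.mul_le_mul_left _ h
    simp only [attachSquares]
    omega

theorem attach_sepY_inr_inr (hQ : IsComb Q act) (hL : ∀ w, (R w).y + (R w).s ≤ L)
    {v v' : act} {i i' : Fin M} (h : (v, i) ≠ (v', i')) (w w' : W) :
    (attachSquares Q act R M L (.inr (v, i, w))).SepY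
      (attachSquares Q act R M L (.inr (v', i', w'))) := by
  by_cases hv : v = v'
  · subst hv
    have hi : i ≠ i' := fun hi => h (by rw [hi])
    have h1 := hL w
    have h2 := hL w'
    simp only [SepY, attachSquares]
    rcases lt_or_gt_of_ne hi with hi | hi
    · have h3 : ((i : ℕ) + 1) * L ≤ i' * L := Nat.mul_le_mul_right L hi
      rw [add_mul] at h3
      omega
    · have h3 : ((i' : ℕ) + 1) * L ≤ i * L := Nat.mul_le_mul_right L hi
      rw [add_mul] at h3
      omega
  · have h0 : (Q v).SepY (Q v') := by
      rcases hQ.free v' v'.2 v (fun hh => hv (Subtype.ext hh)) with h | h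
      · exact h
      · have := hQ.act_x v v.2
        omega
    have h1 := copy_y_range hL i w
    have h2 := copy_y_range hL i' w'
    simp only [SepY, attachSquares, hQ.act_s v v.2, hQ.act_s v' v'.2] at h0 ⊢
    rcases h0 with h | h
    · have := scale_le (M * L + 1) h
      omega
    · have := scale_le (M * L + 1) h
      omega

theorem Square.Sep.ne {p q : Square} (h : p.Sep q) (hp : 0 < p.s) : p ≠ q := by
  rintro rfl
  simp only [Sep] at h
  omega

theorem Square.Sep.symm {p q : Square} (h : p.Sep q) : q.Sep p := by
  simp only [Sep] at h ⊢
  omega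

theorem attach_pos (hQ : IsComb Q act) {actR : Set W} (hR : IsComb R actR) (p) :
    0 < (attachSquares Q act R M L p).s := by
  rcases p with v | ⟨v, i, w⟩
  · exact Nat.mul_pos (Nat.succ_pos _) (hQ.pos v)
  · exact hR.pos w

theorem IsComb.attach {actR : Set W} (hQ : IsComb Q act) (hR : IsComb R actR) (hM : 1 ≤ M)
    (hL : ∀ w, (R w).y + (R w).s ≤ L) (hL' : ∀ w, (R w).x + (R w).s ≤ L) :
    IsComb (attachSquares Q act R M L) {p | ∃ v i, ∃ w ∈ actR, p = .inr (v, i, w)} where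
  inj := by
    have hlr : ∀ u v i w, attachSquares Q act R M L (.inl u) ≠
        attachSquares Q act R M L (.inr (v, i, w)) := by
      intro u v i w h
      by_cases hu : u = v
      · -- The enlarged square has side length `M * L + 1`, the copy at most `L`.
        have h1 := hL' w
        have h2 : 1 * L ≤ M * L := Nat.mul_le_mul_right L hM
        have h3 := congrArg Square.s h
        simp only [attachSquares, hu, hQ.act_s v v.2] at h3
        omega
      · exact (attach_sep_inl_inr hQ hM hL hL' hu i w).ne (attach_pos hQ hR _) h.symm
    rintro (u | ⟨v, i, w⟩) (u' | ⟨v', i', w'⟩) h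
    · refine congrArg _ (hQ.inj ?_)
      simp only [attachSquares, Square.mk.injEq, Nat.add_right_cancel_iff,
        Nat.mul_right_inj (Nat.succ_ne_zero (M * L))] at h
      rcases hu : Q u with ⟨a, b, c⟩
      rcases hu' : Q u' with ⟨a', b', c'⟩
      rw [hu, hu'] at h
      obtain ⟨rfl, rfl, rfl⟩ := h
      rfl
    · exact absurd h (hlr _ _ _ _)
    · exact absurd h.symm (hlr _ _ _ _)
    · by_cases hvi : (v, i) = (v', i')
      · obtain ⟨rfl, rfl⟩ := Prod.mk.inj hvi
        have : w = w' := by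
          apply hR.inj
          simp only [attachSquares, Square.mk.injEq, Nat.add_left_cancel_iff] at h
          rcases hw : R w with ⟨a, b, c⟩
          rcases hw' : R w' with ⟨a', b', c'⟩
          rw [hw, hw'] at h
          obtain ⟨rfl, rfl, rfl⟩ := h
          rfl
        rw [this]
      · exact absurd h ((attach_sepY_inr_inr hQ hL hvi w w').sep.ne (attach_pos hQ hR _))
  pos := attach_pos hQ hR
  act_x := by
    rintro _ ⟨v, i, w, hw, rfl⟩
    exact hR.act_x w hw
  act_s := by
    rintro _ ⟨v, i, w, hw, rfl⟩
    exact hR.act_s w hw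
  free := by
    rintro _ ⟨v, i, w, hw, rfl⟩ (u | ⟨v', i', w'⟩) hne
    · exact .inr (Nat.le_add_left _ _)
    · by_cases hvi : (v', i') = (v, i)
      · obtain ⟨rfl, rfl⟩ := Prod.mk.inj hvi
        rcases hR.free w hw w' (fun h => hne (by rw [h])) with h | h
        · left
          simp only [SepY, attachSquares] at h ⊢
          omega
        · exact .inr h
      · exact .inl (attach_sepY_inr_inr hQ hL hvi w' w)

/-- Properness of colourings is preserved if the colours on each copy of `R` either avoid the
colour of the square the copy is attached to or belong to squares left of the line `x = 1`. -/
theorem attach_coloring {C : Type*} {col : V → C} {colR : act → W → C}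
    (hQ : IsComb Q act) (hM : 1 ≤ M)
    (hL : ∀ w, (R w).y + (R w).s ≤ L) (hL' : ∀ w, (R w).x + (R w).s ≤ L)
    (hcol : ∀ u v, u ≠ v → col u = col v → (Q u).Sep (Q v))
    (hcolR : ∀ v w w', w ≠ w' → colR v w = colR v w' → (R w).Sep (R w'))
    (havoid : ∀ v w, colR v w = col v → (R w).x + (R w).s ≤ 1)
    (p q : V ⊕ act × Fin M × W) (hpq : p ≠ q)
    (h : Sum.elim col (fun p => colR p.1 p.2.2) p = Sum.elim col (fun p => colR p.1 p.2.2) q) :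
    (attachSquares Q act R M L p).Sep (attachSquares Q act R M L q) := by
  have hlr : ∀ u v i w, colR v w = col u → (attachSquares Q act R M L (.inr (v, i, w))).Sep
      (attachSquares Q act R M L (.inl u)) := by
    intro u v i w h
    by_cases hu : u = v
    · subst hu
      left
      have := havoid v w h
      simp only [attachSquares]
      omega
    · exact attach_sep_inl_inr hQ hM hL hL' hu i w
  rcases p with u | ⟨v, i, w⟩ <;> rcases q with u' | ⟨v', i', w'⟩
  · have := hcol u u' (fun hh => hpq (by rw [hh])) h
    simp only [Square.Sep, attachSquares] at this ⊢
    rcases this with h | h | h | h <;> have := scale_le (M * L + 1) h <;> omega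
  · exact (hlr _ _ _ _ h.symm).symm
  · exact hlr _ _ _ _ h
  · by_cases hvi : (v, i) = (v', i')
    · obtain ⟨rfl, rfl⟩ := Prod.mk.inj hvi
      have := hcolR v w w' (fun hh => hpq (by rw [hh])) h
      simp only [Square.Sep, attachSquares] at this ⊢
      omega
    · exact (attach_sepY_inr_inr hQ hL hvi w w').sep

end attachSquares

/-- A new active square `[0, 1] × [y, y + 1]` touches the old active square it is attached to, whose
left side lies on the line `x = 1` after the shift. -/
theorem forcesReach_attachSquares {V W : Type} [Finite V] [Finite W] {Q : V → Square}
    {act : Set V} {R : W → Square} {actR : Set W} {M L k m n : ℕ} (hQ : IsComb Q act)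
    (hR : IsComb R actR) (hL : ∀ w, (R w).y + (R w).s ≤ L)
    (h : ForcesReach (Square.graph Q) act k m M)
    (h' : ForcesReach (Square.graph R) actR (k + 1) n M) :
    ForcesReach (Square.graph (attachSquares Q act R M L))
      {p | ∃ v i, ∃ w ∈ actR, p = .inr (v, i, w)} (k + 1) (m + n) M := by
  refine h.attach h' _ (fun a b hab => ⟨fun hh => hab.1 (Sum.inl_injective hh), ?_⟩)
    (fun v i a b hab => ⟨fun hh => hab.1 (by simpa using hh), ?_⟩)
    (fun v i w hw => ⟨Sum.inl_ne_inr, ?_⟩)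
  · obtain ⟨-, h1, h2, h3, h4⟩ := hab
    have h1 := Nat.mul_le_mul_left (M * L + 1) h1
    have h2 := Nat.mul_le_mul_left (M * L + 1) h2
    have h3 := Nat.mul_le_mul_left (M * L + 1) h3
    have h4 := Nat.mul_le_mul_left (M * L + 1) h4
    simp only [Meets, attachSquares, mul_add] at h1 h2 h3 h4 ⊢
    omega
  · obtain ⟨-, h1, h2, h3, h4⟩ := hab
    simp only [Meets, attachSquares]
    omega
  · have h1 := copy_y_range hL i w
    simp only [Meets, attachSquares, hQ.act_x v v.2, hQ.act_s v v.2, hR.act_x w hw,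
      hR.act_s w hw] at h1 ⊢
    omega

theorem exists_extent_bound {W : Type*} [Finite W] (f : W → ℕ) : ∃ L, ∀ w, f w ≤ L := by
  obtain ⟨L, hL⟩ := (Set.finite_range f).bddAbove
  exact ⟨L, fun w => hL ⟨w, rfl⟩⟩

theorem isComb_single : IsComb (fun _ : Unit => (⟨0, 0, 1⟩ : Square)) Set.univ where
  inj _ _ _ := rfl
  pos _ := Nat.one_pos
  act_x _ _ := rfl
  act_s _ _ := rfl
  free _ _ _ h := absurd rfl h

/-- The family is constructed by induction on the number `t + 1` of colours and on `k`. For one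
colour, the attached copies are single unit squares, which do not overlap the squares they are
attached to and may share their colour. -/
theorem exists_comb (M : ℕ) (hM : 1 ≤ M) (t k : ℕ) :
    ∃ (V : Type) (_ : Fintype V) (Q : V → Square) (act : Set V) (col : V → Fin (t + 1)),
      IsComb Q act ∧ (∀ u v, u ≠ v → col u = col v → (Q u).Sep (Q v)) ∧
      ForcesReach (Square.graph Q) act k ((k + (t + 1)).choose (t + 1)) M := by
  classical
  have step : ∀ {t k m n : ℕ} {V W : Type} [Fintype V] [Fintype W] {Q : V → Square}
      {act : Set V} {R : W → Square} {actR : Set W} {col : V → Fin (t + 1)}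
      (colR : act → W → Fin (t + 1)), IsComb Q act → IsComb R actR →
      (∀ u v, u ≠ v → col u = col v → (Q u).Sep (Q v)) →
      (∀ v w w', w ≠ w' → colR v w = colR v w' → (R w).Sep (R w')) →
      (∀ v w, colR v w = col v → (R w).x + (R w).s ≤ 1) →
      ForcesReach (Square.graph Q) act k m M →
      ForcesReach (Square.graph R) actR (k + 1) n M →
      ∃ (V : Type) (_ : Fintype V) (Q : V → Square) (act : Set V) (col : V → Fin (t + 1)),
        IsComb Q act ∧ (∀ u v, u ≠ v → col u = col v → (Q u).Sep (Q v)) ∧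
        ForcesReach (Square.graph Q) act (k + 1) (m + n) M := by
    intro t k m n V W _ _ Q act R actR col colR hQ hR hcol hcolR havoid h h'
    obtain ⟨L, hL⟩ := exists_extent_bound fun w => (R w).x + (R w).y + (R w).s
    have hy : ∀ w, (R w).y + (R w).s ≤ L := fun w => by have := hL w; omega
    have hx : ∀ w, (R w).x + (R w).s ≤ L := fun w => by have := hL w; omega
    exact ⟨V ⊕ act × Fin M × W, inferInstance, attachSquares Q act R M L, _, _,
      hQ.attach hR hM hy hx, attach_coloring hQ hM hy hx hcol hcolR havoid,
      forcesReach_attachSquares hQ hR hy h h'⟩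
  have base : ∀ t, ∃ (V : Type) (_ : Fintype V) (Q : V → Square) (act : Set V)
      (col : V → Fin (t + 1)), IsComb Q act ∧
      (∀ u v, u ≠ v → col u = col v → (Q u).Sep (Q v)) ∧
      ForcesReach (Square.graph Q) act 0 ((0 + (t + 1)).choose (t + 1)) M := by
    intro t
    refine ⟨Unit, inferInstance, _, _, fun _ => 0, isComb_single, fun _ _ h => absurd rfl h, ?_⟩
    rw [zero_add, Nat.choose_self]
    exact forcesReach_one _ Set.univ_nonempty _ _
  induction t generalizing k with
  | zero =>
    induction k with
    | zero => exact base 0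
    | succ k ih =>
      obtain ⟨V, _, Q, act, col, hQ, hcol, h⟩ := ih
      have := step (fun v (_ : Unit) => col v) hQ isComb_single hcol
        (fun _ _ _ h => absurd rfl h) (fun _ _ _ => le_rfl) h
        (forcesReach_one _ Set.univ_nonempty _ _)
      simpa using this
  | succ t iht =>
    induction k with
    | zero => exact base (t + 1)
    | succ k ih =>
      obtain ⟨V, _, Q, act, col, hQ, hcol, h⟩ := ih
      obtain ⟨W, _, R, actR, colR, hR, hcolR, h'⟩ := iht (k + 1)
      have := step (fun v w => (col v).succAbove (colR w)) hQ hR hcol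
        (fun v w w' hne hc => hcolR w w' hne (Fin.succAbove_right_injective hc))
        (fun v w hc => absurd hc (Fin.succAbove_ne _ _)) h h'
      have hch : (k + 1 + (t + 1 + 1)).choose (t + 1 + 1) =
          (k + (t + 1 + 1)).choose (t + 1 + 1) + (k + 1 + (t + 1)).choose (t + 1) := by
        rw [show k + 1 + (t + 1 + 1) = (k + 1 + (t + 1)) + 1 by ring, Nat.choose_succ_succ,
          show k + (t + 1 + 1) = k + 1 + (t + 1) by ring, add_comm]
      rwa [hch]

end Squares

/-! ### Realising coloured squares by touching hypercubes -/

section Squares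

open Square

/-- The smallest vertex of the product of a square with the cube of the same side length in `ℝ^d`
that has the origin as a vertex and lies in the orthant with signs `σ`. -/
def Square.corner (q : Square) {d : ℕ} (σ : Fin d → Bool) : Fin (d + 2) → ℝ :=
  Fin.cons (q.x : ℝ) (Fin.cons (q.y : ℝ) fun i => if σ i then 0 else -(q.s : ℝ))

/-- The product of a square with the cube of the same side length in `ℝ^d` that has the origin as
a vertex and lies in the orthant with signs `σ`. For `d = 0` this is the square itself. -/
def Square.cube (q : Square) {d : ℕ} (σ : Fin d → Bool) : Set (Fin (d + 2) → ℝ) :=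
  Set.Icc (q.corner σ) (fun j => q.corner σ j + q.s)

theorem Square.corner_le (q : Square) {d : ℕ} (σ : Fin d → Bool) :
    q.corner σ ≤ fun j => q.corner σ j + q.s :=
  fun _ => le_add_of_nonneg_right (Nat.cast_nonneg _)

theorem Square.isHypercube_cube {q : Square} (hq : 0 < q.s) {d : ℕ} (σ : Fin d → Bool) :
    IsHypercube (q.cube σ) :=
  ⟨_, q.s, Nat.cast_pos.2 hq, rfl⟩

/-- All cubes used in the last `d` coordinates contain the origin, so only the squares decide
about intersections. -/
theorem Square.cube_inter_nonempty_iff (p q : Square) {d : ℕ} (σ τ : Fin d → Bool) :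
    (p.cube σ ∩ q.cube τ).Nonempty ↔ p.Meets q := by
  have hp : (0 : ℝ) ≤ p.s := Nat.cast_nonneg _
  have hq : (0 : ℝ) ≤ q.s := Nat.cast_nonneg _
  rw [cube, cube, Icc_inter_Icc_nonempty_iff (p.corner_le σ) (q.corner_le τ)]
  simp only [Fin.forall_fin_succ, corner, Fin.cons_zero, Fin.cons_succ, Meets]
  have h : ∀ i, ((if σ i then 0 else -(p.s : ℝ)) ≤ (if τ i then 0 else -(q.s : ℝ)) + q.s) ∧
      ((if τ i then 0 else -(q.s : ℝ)) ≤ (if σ i then 0 else -(p.s : ℝ)) + p.s) := by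
    intro i
    split_ifs <;> constructor <;> linarith
  constructor
  · rintro ⟨⟨h1, h2⟩, ⟨h3, h4⟩, -⟩
    exact ⟨by exact_mod_cast h1, by exact_mod_cast h2, by exact_mod_cast h3,
      by exact_mod_cast h4⟩
  · rintro ⟨h1, h2, h3, h4⟩
    exact ⟨⟨by exact_mod_cast h1, by exact_mod_cast h2⟩,
      ⟨by exact_mod_cast h3, by exact_mod_cast h4⟩, h⟩

theorem Square.not_sep_of_mem_interior {p q : Square} {d : ℕ} {σ τ : Fin d → Bool}
    {a : Fin (d + 2) → ℝ} (hp : a ∈ interior (p.cube σ)) (hq : a ∈ interior (q.cube τ)) :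
    ¬ p.Sep q := by
  have h0 := interior_Icc_pi hp 0
  have h1 := interior_Icc_pi hp 1
  have h2 := interior_Icc_pi hq 0
  have h3 := interior_Icc_pi hq 1
  simp only [corner, Fin.cons_zero, Fin.cons_one] at h0 h1 h2 h3
  rintro (h | h | h | h)
  all_goals
    have h' := (Nat.cast_le (α := ℝ)).2 h
    push_cast at h'
    linarith [h0.1, h0.2, h1.1, h1.2, h2.1, h2.2, h3.1, h3.2]

theorem Square.orthant_eq_of_mem_interior {p q : Square} {d : ℕ} {σ τ : Fin d → Bool}
    {a : Fin (d + 2) → ℝ} (hp : a ∈ interior (p.cube σ)) (hq : a ∈ interior (q.cube τ)) :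
    σ = τ := by
  funext i
  have h0 := interior_Icc_pi hp i.succ.succ
  have h1 := interior_Icc_pi hq i.succ.succ
  simp only [corner, Fin.cons_succ] at h0 h1
  cases hσ : σ i <;> cases hτ : τ i <;> simp only [hσ, hτ, if_true, if_false,
    Bool.false_eq_true] at h0 h1 ⊢ <;> linarith [h0.1, h0.2, h1.1, h1.2]

theorem Square.cube_injective {d : ℕ} {σ τ : Fin d → Bool} {p q : Square}
    (h : p.cube σ = q.cube τ) : p = q := by
  obtain ⟨hl, hg⟩ := Icc_ends_eq (p.corner_le σ) (q.corner_le τ) h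
  have h0 := congrFun hl 0
  have h1 := congrFun hl 1
  have h2 := congrFun hg 0
  simp only [hl, add_right_inj] at h2
  simp only [corner, Fin.cons_zero, Fin.cons_one] at h0 h1
  rcases p with ⟨a, b, c⟩
  rcases q with ⟨a', b', c'⟩
  simp only [Nat.cast_inj] at h0 h1 h2
  rw [h0, h1, h2]

theorem Square.graph_eq_meetGraph {V : Type*} (Q : V → Square) {d : ℕ} (σ : V → Fin d → Bool) :
    Square.graph Q = meetGraph fun v => (Q v).cube (σ v) := by
  ext u v
  exact and_congr_right fun _ => (cube_inter_nonempty_iff _ _ _ _).symm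

/-- Placing squares of different colours in different orthants of `ℝ^d` turns a family of squares
coloured with at most `2 ^ d` colours into a touching family of hypercubes. -/
theorem exists_touching_hypercubes {V C : Type} [Fintype V] [Fintype C] {Q : V → Square}
    (hpos : ∀ v, 0 < (Q v).s) {col : V → C}
    (hcol : ∀ u v, u ≠ v → col u = col v → (Q u).Sep (Q v)) {d : ℕ}
    (hd : Fintype.card C ≤ 2 ^ d) (hQ : Function.Injective Q) :
    ∃ S : Finset (Set (Fin (d + 2) → ℝ)), (∀ u ∈ S, IsHypercube u) ∧ IsTouching S ∧
      Nonempty (Square.graph Q ≃g intersectionGraph S) := by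
  classical
  obtain ⟨e⟩ : Nonempty (C ↪ (Fin d → Bool)) :=
    Function.Embedding.nonempty_of_card_le (by simpa using hd)
  refine ⟨Finset.univ.image fun v => (Q v).cube (e (col v)), ?_, ?_, ?_⟩
  · intro u hu
    obtain ⟨v, -, rfl⟩ := Finset.mem_image.1 hu
    exact isHypercube_cube (hpos v) _
  · refine isThin_image_of_coloring _ (fun _ => ()) fun u v p _ hu hv => ?_
    by_contra hne
    exact not_sep_of_mem_interior hu hv
      (hcol u v hne (e.injective (orthant_eq_of_mem_interior hu hv)))
  · rw [graph_eq_meetGraph Q fun v => e (col v)]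
    exact nonempty_meetGraph_iso fun u v h => hQ (cube_injective h)

theorem exists_thin_squares (k t : ℕ) (hk : 1 ≤ k) (ht : 1 ≤ t) :
    ∃ H : Finset (Set (Fin 2 → ℝ)),
      (∀ u ∈ H, IsHypercube u) ∧ IsThin t H ∧
        (k + t).choose t ≤ wcol (intersectionGraph H) (2 * k) ∧
      ∀ d : ℕ, t ≤ 2 ^ d →
        ∃ S : Finset (Set (Fin (d + 2) → ℝ)), (∀ u ∈ S, IsHypercube u) ∧ IsTouching S ∧
          Nonempty (intersectionGraph S ≃g intersectionGraph H) := by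
  classical
  obtain ⟨t, rfl⟩ := Nat.exists_eq_add_of_le' ht
  obtain ⟨V, _, Q, act, col, hQ, hcol, h⟩ := exists_comb ((k + (t + 1)).choose (t + 1))
    (Nat.choose_pos (Nat.le_add_left _ _)) t k
  have hinj : Function.Injective fun v => (Q v).cube (d := 0) Fin.elim0 :=
    fun u v h => hQ.inj (cube_injective h)
  obtain ⟨e⟩ := nonempty_meetGraph_iso hinj
  rw [← graph_eq_meetGraph Q fun _ => Fin.elim0] at e
  refine ⟨Finset.univ.image fun v => (Q v).cube (d := 0) Fin.elim0, ?_, ?_, ?_, ?_⟩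
  · intro u hu
    obtain ⟨v, -, rfl⟩ := Finset.mem_image.1 hu
    exact isHypercube_cube (hQ.pos v) _
  · have := isThin_image_of_coloring (fun v => (Q v).cube (d := 0) Fin.elim0) col
      fun u v p huv hu hv => by
        by_contra hne
        exact not_sep_of_mem_interior hu hv (hcol u v hne huv)
    rwa [Fintype.card_fin] at this
  · exact le_wcol_of_forcesReach e (by omega) (by omega) h
  · intro d hd
    obtain ⟨S, hS, hS', ⟨e'⟩⟩ :=
      exists_touching_hypercubes hQ.pos hcol (d := d) (by simpa using hd) hQ.inj
    exact ⟨S, hS, hS', ⟨e'.symm.trans e⟩⟩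

end Squares

/-! ### Boxes with integer coordinates -/

/-- The data of the box `[x, x + 1] × [y, y + s] × [z, z + s]`. -/
structure Brick where
  /-- The smallest first coordinate. -/
  x : ℕ
  /-- The smallest second coordinate. -/
  y : ℕ
  /-- The smallest third coordinate. -/
  z : ℕ
  /-- The length in the second and in the third direction. -/
  s : ℕ

namespace Brick

/-- The two boxes are separated by a plane orthogonal to a coordinate axis, which they may
touch. -/
def Sep (p q : Brick) : Prop :=
  p.x + 1 ≤ q.x ∨ q.x + 1 ≤ p.x ∨ p.y + p.s ≤ q.y ∨ q.y + q.s ≤ p.y ∨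
    p.z + p.s ≤ q.z ∨ q.z + q.s ≤ p.z

/-- The two closed boxes intersect. -/
def Meets (p q : Brick) : Prop :=
  (p.x ≤ q.x + 1 ∧ q.x ≤ p.x + 1) ∧ (p.y ≤ q.y + q.s ∧ q.y ≤ p.y + p.s) ∧
    p.z ≤ q.z + q.s ∧ q.z ≤ p.z + p.s

/-- The projections of the two boxes to the second axis do not overlap. -/
def SepY (p q : Brick) : Prop :=
  p.y + p.s ≤ q.y ∨ q.y + q.s ≤ p.y

theorem SepY.sep {p q : Brick} (h : p.SepY q) : p.Sep q := by
  simp only [SepY, Sep] at h ⊢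
  omega

theorem Sep.symm {p q : Brick} (h : p.Sep q) : q.Sep p := by
  simp only [Sep] at h ⊢
  omega

/-- The intersection graph of a family of boxes. -/
def graph {V : Type*} (Q : V → Brick) : SimpleGraph V where
  Adj u v := u ≠ v ∧ (Q u).Meets (Q v)
  symm := ⟨fun _ _ h => ⟨h.1.symm, h.2.1.symm, h.2.2.1.symm, h.2.2.2.symm⟩⟩
  loopless := ⟨fun _ h => h.1 rfl⟩

/-- The box as a subset of `ℝ^3`. -/
def toSet (q : Brick) : Set (Fin 3 → ℝ) :=
  Set.Icc ![(q.x : ℝ), q.y, q.z] ![(q.x : ℝ) + 1, (q.y : ℝ) + q.s, (q.z : ℝ) + q.s]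

theorem corner_le (q : Brick) : ![(q.x : ℝ), q.y, q.z] ≤
    ![(q.x : ℝ) + 1, (q.y : ℝ) + q.s, (q.z : ℝ) + q.s] := fun j => by
  fin_cases j <;> simp

theorem toSet_inter_nonempty_iff (p q : Brick) : (p.toSet ∩ q.toSet).Nonempty ↔ p.Meets q := by
  rw [toSet, toSet, Icc_inter_Icc_nonempty_iff p.corner_le q.corner_le]
  simp only [Fin.forall_fin_succ, Meets, Matrix.cons_val_zero, Matrix.cons_val_succ,
    IsEmpty.forall_iff, and_true]
  norm_cast

theorem not_sep_of_mem_interior {p q : Brick} {a : Fin 3 → ℝ} (hp : a ∈ interior p.toSet)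
    (hq : a ∈ interior q.toSet) : ¬ p.Sep q := by
  have h0 := interior_Icc_pi hp 0
  have h1 := interior_Icc_pi hp 1
  have h2 := interior_Icc_pi hp 2
  have h3 := interior_Icc_pi hq 0
  have h4 := interior_Icc_pi hq 1
  have h5 := interior_Icc_pi hq 2
  simp only [Matrix.cons_val] at h0 h1 h2 h3 h4 h5
  rintro (h | h | h | h | h | h)
  all_goals
    have h' := (Nat.cast_le (α := ℝ)).2 h
    push_cast at h'
    linarith [h0.1, h0.2, h1.1, h1.2, h2.1, h2.2, h3.1, h3.2, h4.1, h4.2, h5.1, h5.2]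

theorem isBox_toSet {q : Brick} (hq : 0 < q.s) : IsBox q.toSet := by
  refine ⟨_, _, fun i => ?_, rfl⟩
  fin_cases i <;> simp [hq]

theorem toSet_injective {p q : Brick} (h : p.toSet = q.toSet) : p = q := by
  obtain ⟨hl, hg⟩ := Icc_ends_eq p.corner_le q.corner_le h
  have h0 := congrFun hl 0
  have h1 := congrFun hl 1
  have h2 := congrFun hl 2
  have h3 := congrFun hg 1
  simp only [Matrix.cons_val] at h0 h1 h2 h3
  rw [h1] at h3
  rcases p with ⟨a, b, c, d⟩
  rcases q with ⟨a', b', c', d'⟩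
  simp only [Nat.cast_inj, add_right_inj] at h0 h1 h2 h3
  rw [h0, h1, h2, h3]

theorem exists_translate_subset {p q : Brick} (h : p.s ≤ q.s) :
    ∃ c : Fin 3 → ℝ, (fun x => c + x) '' p.toSet ⊆ q.toSet := by
  have h' : (p.s : ℝ) ≤ q.s := Nat.cast_le.2 h
  refine ⟨![(q.x : ℝ), q.y, q.z] - ![(p.x : ℝ), p.y, p.z], ?_⟩
  rintro _ ⟨a, ⟨hl, hu⟩, rfl⟩
  constructor <;> intro i <;> have h1 := hl i <;> have h2 := hu i <;> fin_cases i <;>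
    simp [Matrix.cons_val] at h1 h2 ⊢ <;> linarith

end Brick

/-! ### Recursive families of boxes -/

/-- A family of boxes with disjoint interiors and a set `act` of active members. The active boxes
are unit cubes with `x = z = 0`, and below the plane `z = 1` no other box enters the interior of
the slab of points whose second coordinate occurs in an active box. -/
structure IsTiling {V : Type*} (Q : V → Brick) (act : Set V) : Prop where
  pos : ∀ v, 0 < (Q v).s
  sep : ∀ u v, u ≠ v → (Q u).Sep (Q v)
  act_x : ∀ v ∈ act, (Q v).x = 0
  act_z : ∀ v ∈ act, (Q v).z = 0
  act_s : ∀ v ∈ act, (Q v).s = 1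
  free : ∀ v ∈ act, ∀ u, u ≠ v → (Q u).SepY (Q v) ∨ 1 ≤ (Q u).z

/-- The family obtained from `Q` as follows. The second and third coordinates are enlarged by the
factor `N * L`, where `L` bounds the extent of `Q`, and everything is raised by `1`. Next to each
active box, in the first direction, a copy of `Q` is placed for which the factor is only `N`.
Below each active box of the copies there are `N` unit cubes, at the first coordinate of the
original family. -/
def bridgeBricks {V : Type*} (Q : V → Brick) (act : Set V) (N L : ℕ) :
    V ⊕ act × V ⊕ act × act × Fin N → Brick
  | .inl v => ⟨(Q v).x, N * L * (Q v).y, N * L * (Q v).z + 1, N * L * (Q v).s⟩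
  | .inr (.inl (v, w)) =>
    ⟨(Q w).x + 1, N * L * (Q v).y + N * (Q w).y, N * (Q w).z + 1, N * (Q w).s⟩
  | .inr (.inr (v, w, i)) => ⟨0, N * L * (Q v).y + N * (Q w).y + i, 0, 1⟩

section bridgeBricks

variable {V : Type*} {Q : V → Brick} {act : Set V} {N L : ℕ}

theorem IsTiling.sepY (hQ : IsTiling Q act) (v v' : act) (h : v ≠ v') : (Q v).SepY (Q v') := by
  rcases hQ.free v' v'.2 v (fun hh => h (Subtype.ext hh)) with h | h
  · exact h
  · have := hQ.act_z v v.2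
    omega

theorem bridge_sep_copy (hQ : IsTiling Q act) (hy : ∀ v, (Q v).y + (Q v).s ≤ L)
    (hz : ∀ v, (Q v).z + (Q v).s ≤ L) (u : V) (v : act) (w : V) :
    (bridgeBricks Q act N L (.inl u)).Sep (bridgeBricks Q act N L (.inr (.inl (v, w)))) := by
  have h1 := scale_le N (hy w)
  have h2 := scale_le N (hz w)
  by_cases hu : u = v
  · left
    simp only [bridgeBricks, hu, hQ.act_x v v.2]
    omega
  · have h3 := hQ.free v v.2 u hu
    simp only [Brick.SepY, Brick.Sep, bridgeBricks, hQ.act_s v v.2] at h3 ⊢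
    rcases h3 with (h3 | h3) | h3
    · have := scale_le (N * L) h3
      omega
    · have := scale_le (N * L) h3
      omega
    · have := Nat.mul_le_mul_left (N * L) h3
      omega

theorem bridge_sepY_copy (hQ : IsTiling Q act) {v v' : act} (h : v ≠ v') {w w' a b : ℕ} (hw : w + a ≤ N * L) (hw' : w' + b ≤ N * L) :
    N * L * (Q v).y + w + a ≤ N * L * (Q v').y + w' ∨
      N * L * (Q v').y + w' + b ≤ N * L * (Q v).y + w := by
  have h1 := hQ.sepY v v' h
  simp only [Brick.SepY, hQ.act_s v v.2, hQ.act_s v' v'.2] at h1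
  rcases h1 with h1 | h1
  · have := scale_le (N * L) h1
    omega
  · have := scale_le (N * L) h1
    omega

theorem bridge_sep_copy_copy (hQ : IsTiling Q act) (hy : ∀ v, (Q v).y + (Q v).s ≤ L)
    (v v' : act) (w w' : V) (h : (v, w) ≠ (v', w')) :
    (bridgeBricks Q act N L (.inr (.inl (v, w)))).Sep
      (bridgeBricks Q act N L (.inr (.inl (v', w')))) := by
  by_cases hv : v = v'
  · subst hv
    have h1 := hQ.sep w w' (fun hh => h (by rw [hh]))
    simp only [Brick.Sep, bridgeBricks] at h1 ⊢
    rcases h1 with h1 | h1 | h1 | h1 | h1 | h1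
    · omega
    · omega
    all_goals
      have := scale_le N h1
      omega
  · exact Brick.SepY.sep (bridge_sepY_copy hQ hv (scale_le N (hy w)) (scale_le N (hy w')))

theorem connector_y_range (hQ : IsTiling Q act) (hy : ∀ v, (Q v).y + (Q v).s ≤ L) (w : act)
    (i : Fin N) : N * (Q w).y + i + 1 ≤ N * L := by
  have h1 := scale_le N (hy w)
  rw [hQ.act_s w w.2] at h1
  omega

theorem bridge_sepY_connector (hQ : IsTiling Q act) (hy : ∀ v, (Q v).y + (Q v).s ≤ L)
    (v v' w w' : act) (i i' : Fin N) (h : (v, w, i) ≠ (v', w', i')) :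
    (bridgeBricks Q act N L (.inr (.inr (v, w, i)))).SepY
      (bridgeBricks Q act N L (.inr (.inr (v', w', i')))) := by
  by_cases hv : v = v'
  · subst hv
    simp only [Brick.SepY, bridgeBricks]
    by_cases hw : w = w'
    · subst hw
      have hi : (i : ℕ) ≠ i' := fun hh => h (by rw [Fin.ext hh])
      omega
    · have h1 := hQ.sepY w w' hw
      simp only [Brick.SepY, hQ.act_s w w.2, hQ.act_s w' w'.2] at h1
      rcases h1 with h1 | h1
      · have := scale_le N h1
        omega
      · have := scale_le N h1
        omega
  · have := bridge_sepY_copy hQ hv (connector_y_range hQ hy w i) (connector_y_range hQ hy w' i')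
    simp only [Brick.SepY, bridgeBricks]
    omega

theorem IsTiling.bridge (hQ : IsTiling Q act) (hN : 1 ≤ N) (hL : 1 ≤ L)
    (hy : ∀ v, (Q v).y + (Q v).s ≤ L) (hz : ∀ v, (Q v).z + (Q v).s ≤ L) :
    IsTiling (bridgeBricks Q act N L) (Set.range fun q => .inr (.inr q)) where
  pos := by
    rintro (u | ⟨v, w⟩ | ⟨v, w, i⟩)
    · exact Nat.mul_pos (Nat.mul_pos hN hL) (hQ.pos u)
    · exact Nat.mul_pos hN (hQ.pos w)
    · exact Nat.one_pos
  sep := by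
    rintro (u | ⟨v, w⟩ | ⟨v, w, i⟩) (u' | ⟨v', w'⟩ | ⟨v', w', i'⟩) hne
    · have h1 := hQ.sep u u' (fun hh => hne (by rw [hh]))
      simp only [Brick.Sep, bridgeBricks] at h1 ⊢
      rcases h1 with h1 | h1 | h1 | h1 | h1 | h1
      · omega
      · omega
      all_goals
        have := scale_le (N * L) h1
        omega
    · exact bridge_sep_copy hQ hy hz _ _ _
    · simp only [Brick.Sep, bridgeBricks]
      omega
    · exact (bridge_sep_copy hQ hy hz _ _ _).symm
    · exact bridge_sep_copy_copy hQ hy _ _ _ _ (fun hh => hne (by rw [hh]))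
    · simp only [Brick.Sep, bridgeBricks]
      omega
    · simp only [Brick.Sep, bridgeBricks]
      omega
    · simp only [Brick.Sep, bridgeBricks]
      omega
    · exact (bridge_sepY_connector hQ hy _ _ _ _ _ _ (fun hh => hne (by rw [hh]))).sep
  act_x := by
    rintro _ ⟨q, rfl⟩
    rfl
  act_z := by
    rintro _ ⟨q, rfl⟩
    rfl
  act_s := by
    rintro _ ⟨q, rfl⟩
    rfl
  free := by
    rintro _ ⟨⟨v, w, i⟩, rfl⟩ (u | ⟨v', w'⟩ | ⟨v', w', i'⟩) hne
    · exact .inr (Nat.le_add_left _ _)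
    · exact .inr (Nat.le_add_left _ _)
    · exact .inl (bridge_sepY_connector hQ hy _ _ _ _ _ _ (fun hh => hne (by rw [hh])))

end bridgeBricks

/-- A connecting cube has its top face in the plane `z = 1`, which contains the bottom faces of `v`
and `w`, and occupies `0 ≤ x ≤ 1`, while `v` occupies `0 ≤ x ≤ 1` and `w` occupies
`1 ≤ x ≤ 2`. -/
theorem forcesReach_bridgeBricks {V : Type} [Finite V] {Q : V → Brick} {act : Set V}
    {M L k n : ℕ} (hQ : IsTiling Q act) (hy : ∀ v, (Q v).y + (Q v).s ≤ L)
    (h : ForcesReach (Brick.graph Q) act k n M) :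
    ForcesReach (Brick.graph (bridgeBricks Q act (2 * M) L))
      (Set.range fun q => .inr (.inr q)) (k + 1) (n + n + 1) M := by
  refine h.bridge h _ (fun a b hab => ⟨fun hh => hab.1 (Sum.inl_injective hh), ?_⟩)
    (fun v a b hab => ⟨fun hh => hab.1 (by simpa using hh), ?_⟩)
    (fun v w i => ⟨Sum.inl_ne_inr, ?_⟩) (fun v w i => ⟨(fun hh => by cases hh), ?_⟩)
  · obtain ⟨-, ⟨h1, h2⟩, ⟨h3, h4⟩, h5, h6⟩ := hab
    have h3 := Nat.mul_le_mul_left (2 * M * L) h3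
    have h4 := Nat.mul_le_mul_left (2 * M * L) h4
    have h5 := Nat.mul_le_mul_left (2 * M * L) h5
    have h6 := Nat.mul_le_mul_left (2 * M * L) h6
    simp only [Brick.Meets, bridgeBricks, mul_add] at h3 h4 h5 h6 ⊢
    omega
  · obtain ⟨-, ⟨h1, h2⟩, ⟨h3, h4⟩, h5, h6⟩ := hab
    have h3 := Nat.mul_le_mul_left (2 * M) h3
    have h4 := Nat.mul_le_mul_left (2 * M) h4
    have h5 := Nat.mul_le_mul_left (2 * M) h5
    have h6 := Nat.mul_le_mul_left (2 * M) h6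
    simp only [Brick.Meets, bridgeBricks, mul_add] at h3 h4 h5 h6 ⊢
    omega
  · have h1 := connector_y_range hQ hy w i
    simp only [Brick.Meets, bridgeBricks, hQ.act_x v v.2, hQ.act_s v v.2, hQ.act_z v v.2]
    omega
  · have h1 := i.2
    simp only [Brick.Meets, bridgeBricks, hQ.act_x w w.2, hQ.act_s w w.2, hQ.act_z w w.2]
    omega

theorem exists_tiling (M : ℕ) (hM : 1 ≤ M) (k : ℕ) :
    ∃ (V : Type) (_ : Fintype V) (Q : V → Brick) (act : Set V),
      IsTiling Q act ∧ ForcesReach (Brick.graph Q) act k (2 ^ (k + 1) - 1) M := by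
  classical
  induction k with
  | zero =>
    refine ⟨Unit, inferInstance, fun _ => ⟨0, 0, 0, 1⟩, Set.univ, ?_,
      forcesReach_one _ Set.univ_nonempty _ _⟩
    exact ⟨fun _ => Nat.one_pos, fun _ _ h => absurd rfl h, fun _ _ => rfl, fun _ _ => rfl,
      fun _ _ => rfl, fun _ _ _ h => absurd rfl h⟩
  | succ k ih =>
    obtain ⟨V, _, Q, act, hQ, h⟩ := ih
    obtain ⟨L, hL⟩ := exists_extent_bound fun v => (Q v).y + (Q v).z + (Q v).s
    have hy : ∀ v, (Q v).y + (Q v).s ≤ L + 1 := fun v => by have := hL v; omega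
    have hz : ∀ v, (Q v).z + (Q v).s ≤ L + 1 := fun v => by have := hL v; omega
    have hpow : 2 ^ (k + 1 + 1) - 1 = 2 ^ (k + 1) - 1 + (2 ^ (k + 1) - 1) + 1 := by
      have := Nat.one_le_two_pow (n := k + 1)
      rw [pow_succ 2 (k + 1)]
      omega
    rw [hpow]
    exact ⟨_, inferInstance, _, _, hQ.bridge (by omega) (Nat.le_add_left 1 L) hy hz,
      forcesReach_bridgeBricks hQ hy h⟩

theorem exists_comparable_boxes (k : ℕ) (hk : 1 ≤ k) :
    ∃ F : Finset (Set (Fin 3 → ℝ)), IsComparableBoxes F ∧ IsTouching F ∧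
      2 ^ (k + 1) - 1 ≤ wcol (intersectionGraph F) (2 * k) := by
  classical
  have hpow : 1 < 2 ^ (k + 1) := Nat.one_lt_two_pow (Nat.succ_ne_zero k)
  obtain ⟨V, _, Q, act, hQ, h⟩ := exists_tiling (2 ^ (k + 1) - 1) (by omega) k
  have hinj : Function.Injective fun v => (Q v).toSet := by
    intro u v huv
    by_contra hne
    have h1 := hQ.sep u v hne
    rw [Brick.toSet_injective huv] at h1
    have h2 := hQ.pos v
    simp only [Brick.Sep] at h1
    omega
  obtain ⟨e⟩ := nonempty_meetGraph_iso hinj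
  have hgraph : (meetGraph fun v => (Q v).toSet) = Brick.graph Q := by
    ext u v
    exact and_congr_right fun _ => Brick.toSet_inter_nonempty_iff _ _
  rw [hgraph] at e
  refine ⟨Finset.univ.image fun v => (Q v).toSet, ⟨?_, ?_⟩, ?_, ?_⟩
  · intro u hu
    obtain ⟨v, -, rfl⟩ := Finset.mem_image.1 hu
    exact Brick.isBox_toSet (hQ.pos v)
  · intro u hu v hv
    obtain ⟨a, -, rfl⟩ := Finset.mem_image.1 hu
    obtain ⟨b, -, rfl⟩ := Finset.mem_image.1 hv
    rcases le_total (Q a).s (Q b).s with hab | hab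
    · exact .inl (Brick.exists_translate_subset hab)
    · exact .inr (Brick.exists_translate_subset hab)
  · refine isThin_image_of_coloring _ (fun _ => ()) fun u v p _ hu hv => ?_
    by_contra hne
    exact Brick.not_sep_of_mem_interior hu hv (hQ.sep u v hne)
  · exact le_wcol_of_forcesReach e (by omega) (by omega) h

/-! ### Lower bounds for the weak coloring numbers -/

theorem mainTheorem2 (k : ℕ) (hk : 1 ≤ k) :
    (∃ F : Finset (Set (Fin 3 → ℝ)), IsComparableBoxes F ∧ IsTouching F ∧
      2 ^ (k + 1) - 1 ≤ wcol (intersectionGraph F) (2 * k)) ∧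
    ∃ H : ℕ → Finset (Set (Fin 2 → ℝ)),
      (∀ t : ℕ, 1 ≤ t →
        (∀ u ∈ H t, IsHypercube u) ∧ IsThin t (H t) ∧
          (k + t).choose t ≤ wcol (intersectionGraph (H t)) (2 * k)) ∧
      ∀ d : ℕ, 1 ≤ d →
        ∃ Q : Finset (Set (Fin (d + 2) → ℝ)), (∀ u ∈ Q, IsHypercube u) ∧ IsTouching Q ∧
          Nonempty (intersectionGraph Q ≃g intersectionGraph (H (2 ^ d - 1))) := by
  refine ⟨exists_comparable_boxes k hk, ?_⟩
  have hex : ∀ t : ℕ, ∃ H : Finset (Set (Fin 2 → ℝ)), 1 ≤ t →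
      (∀ u ∈ H, IsHypercube u) ∧ IsThin t H ∧
        (k + t).choose t ≤ wcol (intersectionGraph H) (2 * k) ∧
      ∀ d : ℕ, t ≤ 2 ^ d →
        ∃ S : Finset (Set (Fin (d + 2) → ℝ)), (∀ u ∈ S, IsHypercube u) ∧ IsTouching S ∧
          Nonempty (intersectionGraph S ≃g intersectionGraph H) := by
    intro t
    by_cases ht : 1 ≤ t
    · obtain ⟨H, hH⟩ := exists_thin_squares k t hk ht
      exact ⟨H, fun _ => hH⟩
    · exact ⟨∅, fun h => absurd h ht⟩
  choose H hH using hex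
  refine ⟨H, fun t ht => ⟨(hH t ht).1, (hH t ht).2.1, (hH t ht).2.2.1⟩, fun d hd => ?_⟩
  have hpow : 1 < 2 ^ d := Nat.one_lt_two_pow (by omega)
  exact (hH (2 ^ d - 1) (by omega)).2.2.2 d (Nat.sub_le _ _)
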